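/- **Theorem.** For $\alpha>0$, $a<t$ and a real function $g$, write $${}_a\mathcal J_t^{\alpha}g(t)=\frac1{\Gamma(\alpha)}\int_a^t (t-s)^{\alpha-1}g(s)\,ds .$$ Let $\alpha\in(0,1]$, let $B=(B(t))_{t\ge 0}$ be a standard real-valued Brownian motion on a probability space $(\Omega,\mathcal F,\mathbb P)$ (so $\operatorname{Var}B(1)=1$), and let $\Upsilon(t,s)$ be a deterministic real function such that both $(t,s)\mapsto\Upsilon(t,s)$ and $(t,s)\mapsto{}_s\mathcal J_t^{\alpha}\Upsilon(t,s)=\frac1{\Gamma(\alpha)}\int_s^t(t-u)^{\alpha-1}\Upsilon(u,s)\,du$ are continuous on the region $\{(t,s):0<s<t\}$. Suppose that for every $t>0$ the Wiener integrals $\int_0^t\Upsilon(t,r)\,dB(r)$ and $\int_0^t {}_r\mathcal J_t^{\alpha}\Upsilon(t,r)\,dB(r)$ are well defined, i.e. $\Upsilon(t,\cdot)$ and $r\mapsto{}_r\mathcal J_t^{\alpha}\Upsilon(t,r)$ belong to $L^2([0,t])$. Then the process $s\mapsto\int_0^s\Upsilon(s,r)\,dB(r)$, $s>0$, has a jointly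 measurable version. Moreover, let $X=(X_s)_{s>0}$ be any version of it which is jointly measurable in $(s,\omega)$ (up to $ds\otimes\mathbb P$-null sets), and let $t>0$ be such that $$\int_0^t (t-s)^{\alpha-1}\Bigl(\int_0^s|\Upsilon(s,r)|^2\,dr\Bigr)^{1/2}ds<\infty .$$ Then almost surely $s\mapsto (t-s)^{\alpha-1}X_s$ is Lebesgue integrable on $[0,t]$; for almost every $r\in(0,t)$ the function $s\mapsto(t-s)^{\alpha-1}\Upsilon(s,r)$ is Lebesgue integrable on $[r,t]$; and, in the sense of equality in distribution, $${}_0\mathcal J_t^{\alpha}\int_0^t\Upsilon(t,r)\,dB(r):=\frac1{\Gamma(\alpha)}\int_0^t(t-s)^{\alpha-1}X_s\,ds\ \stackrel{d}{=}\ \int_0^t{}_r\mathcal J_t^{\alpha}\Upsilon(t,r)\,dB(r).$$ In particular, if the integrability condition holds for all $t>0$, this identity holds for all $t>0$. -/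

import Mathlib

open MeasureTheory ProbabilityTheory Set
open scoped NNReal ENNReal

noncomputable section

/-- The (Riemann--Liouville) fractional integral of order `α` with lower limit `a`,
`(1 / Γ(α)) ∫_a^t (t - s)^(α - 1) g(s) ds`, evaluated at `t`. -/
def fracIntegral (α a : ℝ) (g : ℝ → ℝ) (t : ℝ) : ℝ :=
  1 / Real.Gamma α * ∫ s in a..t, (t - s) ^ (α - 1) * g s

/-! ### The Wiener integral

The Wiener integral with respect to a real Brownian motion `B` on `(Ω, P)` is the continuous linear
extension to `L²(0, ∞)` of the elementary integral, which sends `∑ cᵢ 1_{(0, uᵢ]}` to `∑ cᵢ B(uᵢ)`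
(so that `1_{(u, v]}` is sent to `B(v) - B(u)`). -/

namespace Wiener

/-- Lebesgue measure on `(0, ∞)`. -/
abbrev halfLine : Measure ℝ := volume.restrict (Ioi 0)

/-- The indicator function of `(0, u]`, as an element of `L²(0, ∞)`. -/
def ind (u : ℝ≥0) : Lp ℝ 2 halfLine :=
  indicatorConstLp 2 (measurableSet_Ioc : MeasurableSet (Ioc (0 : ℝ) u))
    (measure_Ioc_lt_top (μ := halfLine)).ne (1 : ℝ)

/-- The step function `∑ c(u) 1_{(0, u]}` defined by finitely many coefficients `c(u)`. -/
def stepFun : (ℝ≥0 →₀ ℝ) →ₗ[ℝ] Lp ℝ 2 halfLine := Finsupp.linearCombination ℝ ind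

variable {Ω : Type*} {mΩ : MeasurableSpace Ω} {P : Measure Ω} {B : ℝ≥0 → Ω → ℝ}

theorem memLp_eval (hB : IsBrownianReal B P) (u : ℝ≥0) : MemLp (B u) 2 P :=
  (hB.isGaussianProcess.hasGaussianLaw_eval u).memLp_two

/-- The elementary stochastic integral `∑ c(u) B(u)` of the step function `∑ c(u) 1_{(0, u]}`. -/
def stepIntegral (hB : IsBrownianReal B P) : (ℝ≥0 →₀ ℝ) →ₗ[ℝ] Lp ℝ 2 P :=
  Finsupp.linearCombination ℝ fun u => (memLp_eval hB u).toLp (B u)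

/-- The Wiener integral as a map `L²(0, ∞) → L²(P)`: the continuous extension of the elementary
stochastic integral from step functions. -/
def integralL2 (hB : IsBrownianReal B P) : Lp ℝ 2 halfLine →L[ℝ] Lp ℝ 2 P :=
  (stepIntegral hB).extendOfNorm stepFun

theorem inner_ind (u v : ℝ≥0) : inner ℝ (ind u) (ind v) = min (u : ℝ) v := by
  unfold ind
  rw [L2.real_inner_indicatorConstLp_one_indicatorConstLp_one measurableSet_Ioc measurableSet_Ioc
    (measure_Ioc_lt_top (μ := halfLine)).ne (measure_Ioc_lt_top (μ := halfLine)).ne]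
  have h : Ioc (0 : ℝ) u ∩ Ioc 0 v ⊆ Ioi 0 := fun x hx => hx.1.1
  rw [measureReal_restrict_apply (measurableSet_Ioc.inter measurableSet_Ioc),
    inter_eq_left.2 h, Ioc_inter_Ioc]
  simp

theorem inner_eval (hB : IsBrownianReal B P) (u v : ℝ≥0) :
    inner ℝ ((memLp_eval hB u).toLp (B u)) ((memLp_eval hB v).toLp (B v)) = min (u : ℝ) v := by
  have : IsProbabilityMeasure P := hB.isGaussianProcess.isProbabilityMeasure
  have h := hB.covariance_eval u v
  rw [covariance_eq_sub (memLp_eval hB u) (memLp_eval hB v), hB.integral_eval, hB.integral_eval,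
    mul_zero, sub_zero] at h
  rw [L2.inner_def]
  calc _ = ∫ ω, (B u * B v) ω ∂P := by
        refine integral_congr_ae ?_
        filter_upwards [(memLp_eval hB u).coeFn_toLp, (memLp_eval hB v).coeFn_toLp] with ω h1 h2
        simp [h1, h2, mul_comm]
    _ = _ := by rw [h]; simp

/-- The Itô isometry for step functions. -/
theorem norm_stepIntegral (hB : IsBrownianReal B P) (c : ℝ≥0 →₀ ℝ) :
    ‖stepIntegral hB c‖ = ‖stepFun c‖ := by
  have h : ‖stepIntegral hB c‖ ^ 2 = ‖stepFun c‖ ^ 2 := by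
    rw [← real_inner_self_eq_norm_sq, ← real_inner_self_eq_norm_sq]
    simp only [stepIntegral, stepFun, Finsupp.linearCombination_apply, Finsupp.sum, sum_inner,
      inner_sum, real_inner_smul_left, real_inner_smul_right, inner_ind, inner_eval hB]
  exact (sq_eq_sq₀ (norm_nonneg _) (norm_nonneg _)).1 h

/-- Step functions are dense in `L²(0, ∞)`. -/
theorem denseRange_stepFun : DenseRange stepFun := by
  have key : (LinearMap.range stepFun)ᗮ = ⊥ := by
    rw [Submodule.eq_bot_iff]
    intro f hf
    have h0 : ∀ u : ℝ≥0, ∫ x in (0 : ℝ)..u, (Ioi (0 : ℝ)).indicator f x = 0 := by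
      intro u
      have h1 : inner ℝ (ind u) f = 0 := by
        refine (Submodule.mem_orthogonal _ _).1 hf _ ⟨Finsupp.single u 1, ?_⟩
        simp [stepFun]
      unfold ind at h1
      rw [L2.inner_indicatorConstLp_one] at h1
      have hs : Ioc (0 : ℝ) u ∩ Ioi 0 = Ioc 0 (u : ℝ) :=
        inter_eq_left.2 (show Ioc (0 : ℝ) u ⊆ Ioi 0 from fun x hx => hx.1)
      rw [Measure.restrict_restrict measurableSet_Ioc, hs] at h1
      rw [intervalIntegral.integral_of_le u.coe_nonneg, setIntegral_indicator measurableSet_Ioi, hs,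
        h1]
    have hloc : LocallyIntegrable ((Ioi (0 : ℝ)).indicator f) volume := by
      have h2 : MemLp ((Ioi (0 : ℝ)).indicator f) 2 volume :=
        (memLp_indicator_iff_restrict measurableSet_Ioi).2 (Lp.memLp f)
      exact h2.locallyIntegrable (by norm_num)
    have hae := LocallyIntegrable.ae_hasDerivAt_integral hloc
    have hz : ∀ᵐ x ∂halfLine, f x = 0 := by
      rw [ae_restrict_iff' measurableSet_Ioi]
      filter_upwards [hae] with x hx hx0
      have hd := hx 0
      have hc : HasDerivAt (fun x => ∫ y in (0 : ℝ)..x, (Ioi (0 : ℝ)).indicator f y) 0 x := by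
        refine (hasDerivAt_const x (0 : ℝ)).congr_of_eventuallyEq ?_
        filter_upwards [Ioi_mem_nhds hx0] with y hy
        exact h0 ⟨y, le_of_lt hy⟩
      have := hd.unique hc
      rwa [indicator_of_mem hx0] at this
    exact (Lp.eq_zero_iff_ae_eq_zero).2 hz
  have := (Submodule.topologicalClosure_eq_top_iff).2 key
  have h2 := (Submodule.dense_iff_topologicalClosure_eq_top).2 this
  rwa [LinearMap.coe_range] at h2

/-- On step functions the Wiener integral is the elementary stochastic integral. -/
theorem integralL2_stepFun (hB : IsBrownianReal B P) (c : ℝ≥0 →₀ ℝ) :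
    integralL2 hB (stepFun c) = stepIntegral hB c :=
  LinearMap.extendOfNorm_eq denseRange_stepFun
    ⟨1, fun c => by rw [one_mul, norm_stepIntegral]⟩ c

/-- The Itô isometry. -/
theorem norm_integralL2 (hB : IsBrownianReal B P) (f : Lp ℝ 2 halfLine) :
    ‖integralL2 hB f‖ = ‖f‖ := by
  refine denseRange_stepFun.induction_on f ?_ fun c => ?_
  · exact isClosed_eq (by fun_prop) (by fun_prop)
  · rw [integralL2_stepFun, norm_stepIntegral]

theorem memLp_indicator {t : ℝ} {g : ℝ → ℝ} (hg : MemLp g 2 (volume.restrict (Ioc 0 t))) :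
    MemLp ((Ioc 0 t).indicator g) 2 halfLine := by
  rw [memLp_indicator_iff_restrict measurableSet_Ioc,
    Measure.restrict_restrict measurableSet_Ioc,
    inter_eq_left.2 (show Ioc 0 t ⊆ Ioi 0 from fun x hx => hx.1)]
  exact hg

/-- The Wiener integral `∫_0^t g(r) dB(r)` of a square-integrable function `g` on `[0, t]`,
as an element of `L²(P)`. -/
def integral (hB : IsBrownianReal B P) (t : ℝ) (g : ℝ → ℝ)
    (hg : MemLp g 2 (volume.restrict (Ioc 0 t))) : Lp ℝ 2 P :=
  integralL2 hB ((memLp_indicator hg).toLp _)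

/-- `X` is a measurable version of the process `t ↦ ∫_0^t Υ(t, r) dB(r)`, `t > 0`: it is jointly
measurable in time and chance (up to null sets), and for each `t > 0` the random variable `X t`
is almost surely equal to the Wiener integral `∫_0^t Υ(t, r) dB(r)`. -/
structure IsVersion (hB : IsBrownianReal B P) (Υ : ℝ → ℝ → ℝ)
    (hΥ : ∀ t, 0 < t → MemLp (Υ t) 2 (volume.restrict (Ioc 0 t))) (X : ℝ → Ω → ℝ) : Prop where
  aemeasurable : AEMeasurable (fun p : ℝ × Ω => X p.1 p.2) (halfLine.prod P)
  ae_eq : ∀ t (ht : 0 < t), X t =ᵐ[P] integral hB t (Υ t) (hΥ t ht)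

end Wiener

/-- The open region `{(t, s) : 0 < s < t}` of the `ts`-plane. -/
def triangle : Set (ℝ × ℝ) := {p | 0 < p.2 ∧ p.2 < p.1}

/-- The condition `∫_0^t (t - s)^(α - 1) (∫_0^s |Υ(s, r)|² dr)^(1/2) ds < ∞`, with integrals of
nonnegative functions taking values in `[0, ∞]`. -/
def FubiniCondition (α : ℝ) (Υ : ℝ → ℝ → ℝ) (t : ℝ) : Prop :=
  ∫⁻ s in Ioc 0 t, ENNReal.ofReal ((t - s) ^ (α - 1)) *
    (∫⁻ r in Ioc 0 s, ENNReal.ofReal (|Υ s r| ^ 2)) ^ (1 / 2 : ℝ) < ∞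

end

/-! The Wiener integral is a continuous linear map `I : L²(0, ∞) → L²(P)`, so it commutes with
Bochner integrals. Let `f_s` be the slice `Υ(s, ·)` on `(0, s]`. `FubiniCondition` says that `(t -
s)^(α - 1) • f_s` has integrable norm on `(0, t]`. As `s ↦ f_s` is strongly measurable, this family
is Bochner integrable, and `∫ (t - s)^(α - 1) • I f_s ds = I (∫ (t - s)^(α - 1) • f_s ds)`.

It remains to read both Bochner integrals pointwise. By `coeFn_integral_Lp_two`, used once over `P`
and once over `(0, ∞)`, they are the fractional integrals of the paths and of the kernel. The
identity thus holds almost surely, not only in law. The measurable version comes from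
`exists_measurable_version` applied to `s ↦ I f_s`. -/

/-! ### Measurability of maps into `Lᵖ` -/

/-- A function into a second countable space is measurable if its distances to points are. -/
theorem stronglyMeasurable_of_measurable_edist {S E : Type*} [MeasurableSpace S]
    [PseudoEMetricSpace E] [SecondCountableTopology E] {f : S → E}
    (h : ∀ x, Measurable fun s => edist (f s) x) : StronglyMeasurable f := by
  borelize E
  refine Measurable.stronglyMeasurable (measurable_of_isOpen fun U hU => ?_)
  choose! r hr hrU using fun x hx => EMetric.isOpen_iff.1 hU x hx
  -- Lindelöf: countably many of these balls already cover `U`.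
  obtain ⟨T, hTc, hT⟩ := TopologicalSpace.isOpen_iUnion_countable
    (fun x : U => Metric.eball (x : E) (r x)) fun x => Metric.isOpen_eball
  have hU' : U = ⋃ x ∈ T, Metric.eball (x : E) (r x) := by
    rw [hT]
    refine Subset.antisymm (fun x hx => mem_iUnion.2 ⟨⟨x, hx⟩, ?_⟩)
      (iUnion_subset fun x => hrU x x.2)
    exact Metric.mem_eball_self (hr x hx)
  rw [hU', preimage_iUnion₂]
  refine MeasurableSet.biUnion hTc fun x _ => ?_
  exact measurableSet_lt (h x) measurable_const

/-- `L²(ν)` is separable, so distances to fixed points suffice; by Tonelli these depend measurably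
on `s`. -/
theorem stronglyMeasurable_toLp {S T : Type*} [MeasurableSpace S] [MeasurableSpace T]
    {ν : Measure T} [SFinite ν] [IsSeparable ν] {K : S → T → ℝ}
    (hK : Measurable fun p : S × T => K p.1 p.2) (hp : ∀ s, MemLp (K s) 2 ν) :
    StronglyMeasurable fun s => (hp s).toLp (K s) := by
  have : Fact ((2 : ℝ≥0∞) ≠ ∞) := ⟨by simp⟩
  refine stronglyMeasurable_of_measurable_edist fun x => ?_
  have hx := (Lp.stronglyMeasurable x).measurable
  have h : ∀ s, edist ((hp s).toLp (K s)) x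
      = (∫⁻ r, ‖K s r - x r‖ₑ ^ (2 : ℝ) ∂ν) ^ (1 / 2 : ℝ) := by
    intro s
    rw [Lp.edist_def, eLpNorm_congr_ae ((hp s).coeFn_toLp.sub (ae_eq_refl _)),
      eLpNorm_eq_lintegral_rpow_enorm_toReal (by simp) (by simp)]
    simp
  simp_rw [h]
  refine Measurable.pow_const (Measurable.lintegral_prod_right' (f := fun p : S × T =>
    ‖K p.1 p.2 - x p.2‖ₑ ^ (2 : ℝ)) ?_) _
  fun_prop

open Filter Topology in
/-- A strongly measurable family of elements of `Lᵖ` has a jointly measurable version. -/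
theorem exists_measurable_version {S Ω : Type*} [MeasurableSpace S] [MeasurableSpace Ω]
    {P : Measure Ω} {p : ℝ≥0∞} [hp : Fact (1 ≤ p)] {ψ : S → Lp ℝ p P} (hψ : StronglyMeasurable ψ) :
    ∃ X : S → Ω → ℝ, Measurable (fun q : S × Ω => X q.1 q.2) ∧ ∀ s, X s =ᵐ[P] ψ s := by
  classical
  obtain ⟨c, hc, hcψ⟩ := hψ.isSeparable_range
  -- Adding `0` keeps the countable set nonempty, hence the range of a sequence, even when `S` is
  -- empty.
  obtain ⟨d, hd⟩ := (hc.insert 0).exists_eq_range (insert_nonempty _ _)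
  have hden : ∀ k : ℕ, ∀ s, ∃ n, edist (ψ s) (d n) < (2⁻¹ : ℝ≥0∞) ^ k := by
    intro k s
    have h1 : ψ s ∈ closure (range d) :=
      closure_mono (hd ▸ subset_insert 0 c) (hcψ (mem_range_self s))
    obtain ⟨y, ⟨n, rfl⟩, hy⟩ := EMetric.mem_closure_iff.1 h1 ((2⁻¹ : ℝ≥0∞) ^ k)
      (ENNReal.pow_pos (by simp) k)
    exact ⟨n, hy⟩
  -- Choosing the first `d n` within `2⁻ᵏ` of `ψ s` gives a countably valued approximation, whose
  -- pointwise representative `Y k` is jointly measurable.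
  let N : ℕ → S → ℕ := fun k s => Nat.find (hden k s)
  have hN : ∀ k, Measurable (N k) := fun k => measurable_find (hden k) fun n =>
    measurableSet_lt (hψ.edist stronglyMeasurable_const).measurable measurable_const
  have hNd : ∀ k s, edist (ψ s) (d (N k s)) < (2⁻¹ : ℝ≥0∞) ^ k :=
    fun k s => Nat.find_spec (hden k s)
  let Y : ℕ → S × Ω → ℝ := fun k q => d (N k q.1) q.2
  have hY : ∀ k, Measurable (Y k) := fun k => by
    have h1 : Measurable fun q : ℕ × Ω => d q.1 q.2 :=
      measurable_from_prod_countable_right fun n => (Lp.stronglyMeasurable (d n)).measurable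
    exact h1.comp (((hN k).comp measurable_fst).prodMk measurable_snd)
  refine ⟨fun s ω => limUnder atTop fun k => Y k (s, ω),
    (StronglyMeasurable.limUnder fun k => (hY k).stronglyMeasurable).measurable, fun s => ?_⟩
  -- The errors are summable in `Lᵖ` norm, which forces almost everywhere convergence along the
  -- whole sequence.
  have hsum : ∑' k, eLpNorm (d (N k s) - ψ s : Lp ℝ p P) p P ≠ ∞ := by
    have h1 : ∀ k, eLpNorm (d (N k s) - ψ s : Lp ℝ p P) p P ≤ (2⁻¹ : ℝ≥0∞) ^ k := fun k => by
      rw [← Lp.enorm_def, ← edist_eq_enorm_sub, edist_comm]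
      exact (hNd k s).le
    refine ne_top_of_le_ne_top ?_ (ENNReal.tsum_le_tsum h1)
    rw [ENNReal.tsum_geometric]
    simp
  have h2 := summable_norm_of_tsum_eLpNorm_ne_top hp.out
    (fun k => Lp.aestronglyMeasurable (d (N k s) - ψ s)) hsum
  have h3 : ∀ᵐ ω ∂P, ∀ k, (d (N k s) - ψ s : Lp ℝ p P) ω = d (N k s) ω - ψ s ω :=
    ae_all_iff.2 fun k => Lp.coeFn_sub _ _
  filter_upwards [h2, h3] with ω h2 h3
  refine Tendsto.limUnder_eq ?_
  have h4 := (tendsto_zero_iff_norm_tendsto_zero.2 h2.tendsto_atTop_zero).add_const (ψ s ω)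
  simpa only [h3, Y, sub_add_cancel, zero_add] using h4

/-! ### Bochner integrals in `L²` and pointwise integrals -/

/-- By Hölder, the `L¹` norm over `A` is at most `ν(A)^(1/2)` times the `L²` norm. This is the
integrability that Fubini needs on sets of finite measure. -/
theorem integrable_prod_restrict_of_Lp_two {S T : Type*} [MeasurableSpace S] [MeasurableSpace T]
    {μ : Measure S} {ν : Measure T} [SFinite ν] {F : S → Lp ℝ 2 ν}
    (hF : Integrable F μ) {φ : S → T → ℝ}
    (hφ : AEStronglyMeasurable (fun q : S × T => φ q.1 q.2) (μ.prod ν))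
    (hφF : ∀ᵐ s ∂μ, φ s =ᵐ[ν] F s) {A : Set T} (hνA : ν A ≠ ∞) :
    Integrable (fun q : S × T => φ q.1 q.2) (μ.prod (ν.restrict A)) := by
  have hm : AEStronglyMeasurable (fun q : S × T => φ q.1 q.2) (μ.prod (ν.restrict A)) :=
    hφ.mono_ac (Measure.AbsolutelyContinuous.rfl.prod Measure.absolutelyContinuous_restrict)
  refine ⟨hm, ?_⟩
  rw [HasFiniteIntegral, lintegral_prod _ hm.enorm]
  have hb : ∀ᵐ s ∂μ, ∫⁻ x in A, ‖φ s x‖ₑ ∂ν ≤ ‖F s‖ₑ * ν A ^ (1 / 2 : ℝ) := by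
    filter_upwards [hφF] with s hs
    calc ∫⁻ x in A, ‖φ s x‖ₑ ∂ν = eLpNorm (F s) 1 (ν.restrict A) := by
          rw [← eLpNorm_one_eq_lintegral_enorm, eLpNorm_congr_ae (ae_restrict_of_ae hs)]
      _ ≤ eLpNorm (F s) 2 (ν.restrict A) * ν A ^ (1 / 2 : ℝ) := by
          have := eLpNorm_le_eLpNorm_mul_rpow_measure_univ (p := 1) (q := 2) (by norm_num)
            (Lp.aestronglyMeasurable (F s)).restrict (μ := ν.restrict A)
          norm_num at this
          simpa using this
      _ ≤ _ := by
          rw [Lp.enorm_def]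
          gcongr
          exact Measure.restrict_le_self
  refine (lintegral_mono_ae hb).trans_lt ?_
  rw [lintegral_mul_const'' _ hF.aestronglyMeasurable.enorm]
  exact ENNReal.mul_lt_top hF.2 (ENNReal.rpow_lt_top_of_nonneg (by norm_num) hνA)

/-- A Bochner integral in `L²` agrees almost everywhere with the pointwise integral. -/
theorem coeFn_integral_Lp_two {S T : Type*} [MeasurableSpace S] [MeasurableSpace T]
    {μ : Measure S} {ν : Measure T} [SFinite μ] [SigmaFinite ν] {F : S → Lp ℝ 2 ν}
    (hF : Integrable F μ) {φ : S → T → ℝ}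
    (hφ : AEStronglyMeasurable (fun q : S × T => φ q.1 q.2) (μ.prod ν))
    (hφF : ∀ᵐ s ∂μ, φ s =ᵐ[ν] F s) :
    (∫ s, F s ∂μ : Lp ℝ 2 ν) =ᵐ[ν] fun x => ∫ s, φ s x ∂μ := by
  refine ae_eq_of_forall_setIntegral_eq_of_sigmaFinite (fun A hA hνA => ?_)
    (fun A hA hνA => ?_) fun A hA hνA => ?_
  · exact integrableOn_Lp_of_measure_ne_top _ fact_one_le_two_ennreal.elim hνA.ne
  · exact (integrable_prod_restrict_of_Lp_two hF hφ hφF hνA.ne).integral_prod_right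
  -- Integrating over `A` is pairing with `1_A`, a continuous functional that passes under the
  -- Bochner integral; Fubini swaps the other side.
  · rw [← L2.inner_indicatorConstLp_one (𝕜 := ℝ) hA hνA.ne, ← integral_inner hF,
      integral_integral_swap (f := fun x s => φ s x)
        (integrable_prod_restrict_of_Lp_two hF hφ hφF hνA.ne).swap]
    refine integral_congr_ae ?_
    filter_upwards [hφF] with s hs
    rw [L2.inner_indicatorConstLp_one]
    exact integral_congr_ae (ae_restrict_of_ae hs.symm)

/-! ### The kernel and its slices in `L²(0, ∞)` -/

/-- The kernel `Υ`, extended by zero outside the region `0 < r < s`. -/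
noncomputable def volterraKernel (Υ : ℝ → ℝ → ℝ) (s r : ℝ) : ℝ :=
  triangle.indicator (fun p : ℝ × ℝ => Υ p.1 p.2) (s, r)

theorem measurable_volterraKernel {Υ : ℝ → ℝ → ℝ}
    (hcont : ContinuousOn (fun p : ℝ × ℝ => Υ p.1 p.2) triangle) :
    Measurable fun p : ℝ × ℝ => volterraKernel Υ p.1 p.2 := by
  classical
  have hm : MeasurableSet triangle :=
    (measurableSet_lt measurable_const measurable_snd).inter
      (measurableSet_lt measurable_snd measurable_fst)
  have := hcont.measurable_piecewise (g := fun _ => (0 : ℝ)) continuousOn_const hm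
  rwa [← Pi.zero_def, piecewise_eq_indicator] at this

/-- The two functions can differ only on the diagonal `r = s`, a null set. -/
theorem volterraKernel_ae_eq (Υ : ℝ → ℝ → ℝ) (s : ℝ) :
    volterraKernel Υ s =ᵐ[Wiener.halfLine] (Ioc 0 s).indicator (Υ s) := by
  have h : ∀ᵐ r ∂Wiener.halfLine, r ≠ s := ae_restrict_of_ae (Measure.ae_ne volume s)
  filter_upwards [h] with r hr
  have h : (s, r) ∈ triangle ↔ r ∈ Ioc 0 s :=
    and_congr_right fun _ => ⟨le_of_lt, fun h => lt_of_le_of_ne h hr⟩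
  by_cases hrs : r ∈ Ioc 0 s
  · rw [volterraKernel, indicator_of_mem (h.2 hrs), indicator_of_mem hrs]
  · rw [volterraKernel, indicator_of_notMem (mt h.1 hrs), indicator_of_notMem hrs]

theorem memLp_volterraKernel {Υ : ℝ → ℝ → ℝ}
    (hΥ : ∀ t, 0 < t → MemLp (Υ t) 2 (volume.restrict (Ioc 0 t))) (s : ℝ) :
    MemLp (volterraKernel Υ s) 2 Wiener.halfLine := by
  refine MemLp.ae_eq (volterraKernel_ae_eq Υ s).symm ?_
  rcases lt_or_ge 0 s with hs | hs
  · exact Wiener.memLp_indicator (hΥ s hs)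
  · simp [Ioc_eq_empty_of_le hs]

/-- The slice `Υ(s, ·)` on `(0, s]` as an element of `L²(0, ∞)`. -/
noncomputable def volterraLp {Υ : ℝ → ℝ → ℝ}
    (hΥ : ∀ t, 0 < t → MemLp (Υ t) 2 (volume.restrict (Ioc 0 t))) (s : ℝ) : Lp ℝ 2 Wiener.halfLine :=
  (memLp_volterraKernel hΥ s).toLp _

theorem coeFn_smul_volterraLp {Υ : ℝ → ℝ → ℝ}
    (hΥ : ∀ t, 0 < t → MemLp (Υ t) 2 (volume.restrict (Ioc 0 t))) (c s : ℝ) :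
    (c • volterraLp hΥ s : Lp ℝ 2 Wiener.halfLine) =ᵐ[Wiener.halfLine]
      fun r => c * volterraKernel Υ s r := by
  filter_upwards [Lp.coeFn_smul c (volterraLp hΥ s),
    (memLp_volterraKernel hΥ s).coeFn_toLp] with r h1 h2
  rw [h1, Pi.smul_apply, smul_eq_mul, volterraLp, h2]

theorem enorm_volterraLp {Υ : ℝ → ℝ → ℝ}
    (hΥ : ∀ t, 0 < t → MemLp (Υ t) 2 (volume.restrict (Ioc 0 t))) (s : ℝ) :
    ‖volterraLp hΥ s‖ₑ = (∫⁻ r in Ioc 0 s, ENNReal.ofReal (|Υ s r| ^ 2)) ^ (1 / 2 : ℝ) := by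
  have hs : Ioc (0 : ℝ) s ∩ Ioi 0 = Ioc 0 s :=
    inter_eq_left.2 (show Ioc (0 : ℝ) s ⊆ Ioi 0 from fun x hx => hx.1)
  rw [volterraLp, Lp.enorm_toLp, eLpNorm_congr_ae (volterraKernel_ae_eq Υ s),
    eLpNorm_indicator_eq_eLpNorm_restrict measurableSet_Ioc,
    Measure.restrict_restrict measurableSet_Ioc, hs,
    eLpNorm_eq_lintegral_rpow_enorm_toReal (by simp) (by simp)]
  congr 1
  refine lintegral_congr fun r => ?_
  rw [ENNReal.ofReal_pow (abs_nonneg _), ← Real.enorm_eq_ofReal_abs]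
  simp

theorem wienerIntegral_eq_volterraLp {Ω : Type*} [MeasurableSpace Ω] {P : Measure Ω}
    {B : ℝ≥0 → Ω → ℝ} (hB : IsBrownianReal B P) {Υ : ℝ → ℝ → ℝ}
    (hΥ : ∀ t, 0 < t → MemLp (Υ t) 2 (volume.restrict (Ioc 0 t))) {s : ℝ} (hs : 0 < s) :
    Wiener.integral hB s (Υ s) (hΥ s hs) = Wiener.integralL2 hB (volterraLp hΥ s) := by
  rw [Wiener.integral, volterraLp]
  congr 1
  exact (MemLp.toLp_eq_toLp_iff _ _).2 (volterraKernel_ae_eq Υ s).symm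

theorem integrable_rpow_smul_volterraLp {Υ : ℝ → ℝ → ℝ}
    (hcont : ContinuousOn (fun p : ℝ × ℝ => Υ p.1 p.2) triangle)
    (hΥ : ∀ t, 0 < t → MemLp (Υ t) 2 (volume.restrict (Ioc 0 t))) {α t : ℝ}
    (ht : FubiniCondition α Υ t) :
    Integrable (fun s => (t - s) ^ (α - 1) • volterraLp hΥ s) (volume.restrict (Ioc 0 t)) := by
  have hf : StronglyMeasurable (volterraLp hΥ) :=
    stronglyMeasurable_toLp (measurable_volterraKernel hcont) _
  have hw : StronglyMeasurable fun s : ℝ => (t - s) ^ (α - 1) :=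
    (Measurable.pow_const (by fun_prop) _).stronglyMeasurable
  refine ⟨(hw.smul hf).aestronglyMeasurable, ?_⟩
  refine lt_of_eq_of_lt (setLIntegral_congr_fun measurableSet_Ioc fun s hs => ?_) ht
  rw [enorm_smul, enorm_volterraLp,
    Real.enorm_of_nonneg (Real.rpow_nonneg (sub_nonneg.2 hs.2) _)]

/-- The cutoff `r < s` built into the kernel moves the lower limit from `0` to `r`. -/
theorem setIntegral_volterraKernel (Υ : ℝ → ℝ → ℝ) (w : ℝ → ℝ) {t r : ℝ} (hr : 0 < r) :
    ∫ s in Ioc 0 t, w s * volterraKernel Υ s r = ∫ s in Ioc r t, w s * Υ s r := by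
  have h : ∀ s, w s * volterraKernel Υ s r = (Ioi r).indicator (fun s => w s * Υ s r) s := by
    intro s
    by_cases h : r < s <;> simp [volterraKernel, triangle, indicator, h, hr]
  have hs : Ioc 0 t ∩ Ioi r = Ioc r t := by
    ext s; simp only [mem_inter_iff, mem_Ioc, mem_Ioi]
    exact ⟨fun h => ⟨h.2, h.1.2⟩, fun h => ⟨⟨hr.trans h.1, h.2⟩, h.1⟩⟩
  simp_rw [h]
  rw [setIntegral_indicator measurableSet_Ioi, hs]

theorem fracIntegral_volterra_ae_eq {Υ : ℝ → ℝ → ℝ}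
    (hcont : ContinuousOn (fun p : ℝ × ℝ => Υ p.1 p.2) triangle)
    (hΥ : ∀ t, 0 < t → MemLp (Υ t) 2 (volume.restrict (Ioc 0 t))) {α t : ℝ}
    (ht : FubiniCondition α Υ t) :
    (((1 / Real.Gamma α) • ∫ s in Ioc 0 t, (t - s) ^ (α - 1) • volterraLp hΥ s :
        Lp ℝ 2 Wiener.halfLine) : ℝ → ℝ) =ᵐ[Wiener.halfLine]
      (Ioc 0 t).indicator fun r => fracIntegral α r (fun u => Υ u r) t := by
  have h := coeFn_integral_Lp_two (φ := fun s r => (t - s) ^ (α - 1) * volterraKernel Υ s r)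
    (integrable_rpow_smul_volterraLp hcont hΥ ht)
    (((Measurable.pow_const (by fun_prop) _).mul
      (measurable_volterraKernel hcont)).aestronglyMeasurable)
    (.of_forall fun s => (coeFn_smul_volterraLp hΥ _ s).symm)
  filter_upwards [h, Lp.coeFn_smul (1 / Real.Gamma α)
    (∫ s in Ioc 0 t, (t - s) ^ (α - 1) • volterraLp hΥ s), ae_restrict_mem measurableSet_Ioi]
    with r h1 h2 hr
  rw [h2, Pi.smul_apply, h1, setIntegral_volterraKernel Υ _ hr, smul_eq_mul]
  by_cases hrt : r ≤ t
  · rw [indicator_of_mem (show r ∈ Ioc 0 t from ⟨hr, hrt⟩), fracIntegral,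
      intervalIntegral.integral_of_le hrt]
  -- For `r > t` no `s ≤ t` lies beyond `r`, so the integral vanishes.
  · rw [indicator_of_notMem fun h => hrt h.2, Ioc_eq_empty fun h => hrt h.le]
    simp

theorem ae_intervalIntegrable_volterra {Υ : ℝ → ℝ → ℝ}
    (hcont : ContinuousOn (fun p : ℝ × ℝ => Υ p.1 p.2) triangle)
    (hΥ : ∀ t, 0 < t → MemLp (Υ t) 2 (volume.restrict (Ioc 0 t))) {α t : ℝ}
    (ht : FubiniCondition α Υ t) :
    ∀ᵐ r ∂(volume.restrict (Ioc 0 t)),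
      IntervalIntegrable (fun s => (t - s) ^ (α - 1) * Υ s r) volume r t := by
  have hs : Ioc (0 : ℝ) t ∩ Ioi 0 = Ioc 0 t :=
    inter_eq_left.2 (show Ioc (0 : ℝ) t ⊆ Ioi 0 from fun x hx => hx.1)
  have h := integrable_prod_restrict_of_Lp_two (A := Ioc 0 t)
    (φ := fun s r => (t - s) ^ (α - 1) * volterraKernel Υ s r)
    (integrable_rpow_smul_volterraLp hcont hΥ ht)
    (((Measurable.pow_const (by fun_prop) _).mul
      (measurable_volterraKernel hcont)).aestronglyMeasurable)
    (.of_forall fun s => (coeFn_smul_volterraLp hΥ _ s).symm)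
    (measure_Ioc_lt_top (μ := Wiener.halfLine)).ne
  rw [Measure.restrict_restrict measurableSet_Ioc, hs] at h
  filter_upwards [h.prod_left_ae, ae_restrict_mem measurableSet_Ioc] with r h1 hr
  rw [intervalIntegrable_iff_integrableOn_Ioc_of_le hr.2]
  refine (IntegrableOn.mono_set h1 (Ioc_subset_Ioc_left hr.1.le)).congr_fun (fun s hs => ?_)
    measurableSet_Ioc
  simp [volterraKernel, triangle, indicator, hr.1, hs.1]

/-! ### Stochastic Fubini for the Wiener integral -/

namespace Wiener

variable {Ω : Type*} [MeasurableSpace Ω] {P : Measure Ω} {B : ℝ≥0 → Ω → ℝ}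

theorem exists_isVersion (hB : IsBrownianReal B P) {Υ : ℝ → ℝ → ℝ}
    (hcont : ContinuousOn (fun p : ℝ × ℝ => Υ p.1 p.2) triangle)
    (hΥ : ∀ t, 0 < t → MemLp (Υ t) 2 (volume.restrict (Ioc 0 t))) :
    ∃ X : ℝ → Ω → ℝ, Measurable (fun p : ℝ × Ω => X p.1 p.2) ∧ IsVersion hB Υ hΥ X := by
  have hf : StronglyMeasurable (volterraLp hΥ) :=
    stronglyMeasurable_toLp (measurable_volterraKernel hcont) _
  obtain ⟨X, hX, hXf⟩ := exists_measurable_version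
    ((integralL2 hB).continuous.comp_stronglyMeasurable hf)
  refine ⟨X, hX, hX.aemeasurable, fun s hs => ?_⟩
  rw [wienerIntegral_eq_volterraLp]
  exact hXf s

variable {hB : IsBrownianReal B P} {Υ : ℝ → ℝ → ℝ}
    {hΥ : ∀ t, 0 < t → MemLp (Υ t) 2 (volume.restrict (Ioc 0 t))} {X : ℝ → Ω → ℝ}

theorem IsVersion.aestronglyMeasurable_rpow_mul (hX : IsVersion hB Υ hΥ X) (α t : ℝ) :
    AEStronglyMeasurable (fun p : ℝ × Ω => (t - p.1) ^ (α - 1) * X p.1 p.2)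
      ((volume.restrict (Ioc 0 t)).prod P) := by
  have : IsProbabilityMeasure P := hB.isGaussianProcess.isProbabilityMeasure
  have hle : volume.restrict (Ioc 0 t) ≤ halfLine :=
    Measure.restrict_mono_set _ fun x hx => hx.1
  have h1 : AEMeasurable (fun p : ℝ × Ω => X p.1 p.2) ((volume.restrict (Ioc 0 t)).prod P) :=
    hX.aemeasurable.mono_ac (hle.absolutelyContinuous.prod .rfl)
  exact ((Measurable.pow_const (by fun_prop) _).aemeasurable.mul h1).aestronglyMeasurable

theorem IsVersion.rpow_mul_ae_eq (hX : IsVersion hB Υ hΥ X) (α t : ℝ) :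
    ∀ᵐ s ∂(volume.restrict (Ioc 0 t)), (fun ω => (t - s) ^ (α - 1) * X s ω) =ᵐ[P]
      integralL2 hB ((t - s) ^ (α - 1) • volterraLp hΥ s) := by
  filter_upwards [ae_restrict_mem measurableSet_Ioc] with s hs
  rw [map_smul]
  filter_upwards [Lp.coeFn_smul ((t - s) ^ (α - 1)) (integralL2 hB (volterraLp hΥ s)),
    hX.ae_eq s hs.1] with ω h1 h2
  rw [h1, Pi.smul_apply, smul_eq_mul, h2, wienerIntegral_eq_volterraLp]

theorem IsVersion.ae_intervalIntegrable (hX : IsVersion hB Υ hΥ X)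
    (hcont : ContinuousOn (fun p : ℝ × ℝ => Υ p.1 p.2) triangle) {α t : ℝ} (ht0 : 0 ≤ t)
    (ht : FubiniCondition α Υ t) :
    ∀ᵐ ω ∂P, IntervalIntegrable (fun s => (t - s) ^ (α - 1) * X s ω) volume 0 t := by
  have : IsProbabilityMeasure P := hB.isGaussianProcess.isProbabilityMeasure
  have h := integrable_prod_restrict_of_Lp_two (A := univ)
    ((integralL2 hB).integrable_comp (integrable_rpow_smul_volterraLp hcont hΥ ht))
    (hX.aestronglyMeasurable_rpow_mul α t) (hX.rpow_mul_ae_eq α t) (measure_ne_top P univ)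
  rw [Measure.restrict_univ] at h
  filter_upwards [h.prod_left_ae] with ω hω
  exact (intervalIntegrable_iff_integrableOn_Ioc_of_le ht0).2 hω

/-- The stochastic Fubini theorem: the fractional integral of the process `∫_0^s Υ(s, r) dB(r)` is
almost surely the Wiener integral of the fractional integral of the kernel. -/
theorem IsVersion.fracIntegral_ae_eq (hX : IsVersion hB Υ hΥ X)
    (hcont : ContinuousOn (fun p : ℝ × ℝ => Υ p.1 p.2) triangle) {α t : ℝ} (ht0 : 0 ≤ t)
    (ht : FubiniCondition α Υ t)
    (hJ : MemLp (fun r => fracIntegral α r (fun u => Υ u r) t) 2 (volume.restrict (Ioc 0 t))) :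
    integral hB t (fun r => fracIntegral α r (fun u => Υ u r) t) hJ
      =ᵐ[P] fun ω => fracIntegral α 0 (fun s => X s ω) t := by
  have : IsProbabilityMeasure P := hB.isGaussianProcess.isProbabilityMeasure
  have hint := integrable_rpow_smul_volterraLp hcont hΥ ht
  have h := coeFn_integral_Lp_two ((integralL2 hB).integrable_comp hint)
    (hX.aestronglyMeasurable_rpow_mul α t) (hX.rpow_mul_ae_eq α t)
  rw [(integralL2 hB).integral_comp_comm hint] at h
  -- The fractional integral of the kernel and the Bochner integral of the slices are the same
  -- element of `L²(0, ∞)`.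
  have hG : (memLp_indicator hJ).toLp _ =
      (1 / Real.Gamma α) • ∫ s in Ioc 0 t, (t - s) ^ (α - 1) • volterraLp hΥ s :=
    Lp.ext ((memLp_indicator hJ).coeFn_toLp.trans (fracIntegral_volterra_ae_eq hcont hΥ ht).symm)
  rw [integral, hG, map_smul]
  filter_upwards [h, Lp.coeFn_smul (1 / Real.Gamma α)
    (integralL2 hB (∫ s in Ioc 0 t, (t - s) ^ (α - 1) • volterraLp hΥ s))] with ω h1 h2
  rw [h2, Pi.smul_apply, h1, smul_eq_mul, fracIntegral, intervalIntegral.integral_of_le ht0]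

end Wiener

theorem theorem2p1 {Ω : Type*} [MeasurableSpace Ω] {P : Measure Ω} {B : ℝ≥0 → Ω → ℝ}
    (hB : IsBrownianReal B P) {α : ℝ} (hα0 : 0 < α) (hα1 : α ≤ 1) (Υ : ℝ → ℝ → ℝ)
    (hcont : ContinuousOn (fun p : ℝ × ℝ => Υ p.1 p.2) triangle)
    (hJcont : ContinuousOn
      (fun p : ℝ × ℝ => fracIntegral α p.2 (fun u => Υ u p.2) p.1) triangle)
    (hΥ : ∀ t, 0 < t → MemLp (Υ t) 2 (volume.restrict (Ioc 0 t)))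
    (hJ : ∀ t, 0 < t →
      MemLp (fun r => fracIntegral α r (fun u => Υ u r) t) 2 (volume.restrict (Ioc 0 t))) :
    (∃ X : ℝ → Ω → ℝ, Measurable (fun p : ℝ × Ω => X p.1 p.2) ∧ Wiener.IsVersion hB Υ hΥ X) ∧
    ∀ X : ℝ → Ω → ℝ, Wiener.IsVersion hB Υ hΥ X →
      ∀ t (ht : 0 < t), FubiniCondition α Υ t →
        (∀ᵐ ω ∂P, IntervalIntegrable (fun s => (t - s) ^ (α - 1) * X s ω) volume 0 t) ∧
        (∀ᵐ r ∂(volume.restrict (Ioc 0 t)),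
          IntervalIntegrable (fun s => (t - s) ^ (α - 1) * Υ s r) volume r t) ∧
        IdentDistrib (fun ω => fracIntegral α 0 (fun s => X s ω) t)
          (Wiener.integral hB t (fun r => fracIntegral α r (fun u => Υ u r) t) (hJ t ht)) P P := by
  refine ⟨Wiener.exists_isVersion hB hcont hΥ, fun X hX t ht hF =>
    ⟨hX.ae_intervalIntegrable hcont ht.le hF, ae_intervalIntegrable_volterra hcont hΥ hF, ?_⟩⟩
  exact (IdentDistrib.of_ae_eq (Lp.stronglyMeasurable _).measurable.aemeasurable
    (hX.fracIntegral_ae_eq hcont ht.le hF (hJ t ht))).symm
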